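/- Let $\mathcal{T}$ be a triangulated category and let $\mathcal{A}\subset\mathcal{T}$ be a full additive subcategory, closed under extensions, such that $\operatorname{Hom}_{\mathcal{T}}(A,B[-1])=0$ for all $A,B\in\mathcal{A}$ (for example, the heart of a t-structure). A pair of morphisms $B\to X\to A$ in $\mathcal{A}$ is called a conflation $0\to B\to X\to A\to 0$ if it is part of a distinguished triangle $B\to X\to A\xrightarrow{\delta}B[1]$ of $\mathcal{T}$. For $n\ge 1$, an $n$-extension of $A$ by $B$ is a sequence $0\to B\to X_1\to\dots\to X_n\to A\to 0$ in $\mathcal{A}$ obtained by splicing conflations $0\to C_{i-1}\to X_i\to C_i\to 0$ $(1\le i\le n)$ with $C_0=B$, $C_n=A$, and $\operatorname{Ext}^n_{\mathcal{A}}(A,B)$ is the set of $n$-extensions modulo the equivalence relation generated by morphisms of sequences that are the identity on $A$ and on $B$; moreover $\operatorname{Ext}^0_{\mathcal{A}}(A,B)=\operatorname{Hom}_{\mathcal{A}}(A,B)$. The Yoneda product $\operatorname{Ext}^n_{\mathcal{A}}(A,B)\times\operatorname{Ext}^m_{\mathcal{A}}(B,C)\to\operatorname{Ext}^{n+m}_{\mathcal{A}}(A,C)$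 is given by splicing if $n,m\ge1$, by pushout along $B\to C$ if $m=0<n$, by pullback along $A\to B$ if $n=0<m$, and by composition if $n=m=0$. The Baer sum is $\mathbf{X}+\mathbf{Y}=\nabla_B\cdot(\mathbf{X}\oplus\mathbf{Y})\cdot\Delta_A$, with $\Delta_A:A\to A\oplus A$ the diagonal and $\nabla_B:B\oplus B\to B$ the codiagonal. Then, for all $n\ge0$ and $A,B\in\mathcal{A}$, there is a well-defined map $f_{n,A,B}:\operatorname{Ext}^n_{\mathcal{A}}(A,B)\to\operatorname{Hom}_{\mathcal{T}}(A,B[n])$ which is the identification $\operatorname{Hom}_{\mathcal{A}}(A,B)=\operatorname{Hom}_{\mathcal{T}}(A,B)$ for $n=0$ and which, for $n\ge1$, sends the class of an $n$-extension as above to the composition $A\to C_{n-1}[1]\to\dots\to C_1[n-1]\to B[n]$ of the shifts of the morphisms $\delta_i:C_i\to C_{i-1}[1]$ of the corresponding distinguished triangles. The following hold. 1. The image of $f_{n,A,B}$ consists of all morphisms $A\to B[n]$ that factor as $A\to C_{n-1}[1]\to\dots\to C_1[n-1]\to B[n]$ for some $C_1,\dots,C_{n-1}\in\mathcal{A}$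 (for $n\le 1$ this is no condition). 2. The maps $f_{n,A,B}$ send the Yoneda product to composition, i.e. the product of $x\in\operatorname{Ext}^n_{\mathcal{A}}(A,B)$ and $y\in\operatorname{Ext}^m_{\mathcal{A}}(B,C)$ is sent to $f_{m,B,C}(y)[n]\circ f_{n,A,B}(x)$. In particular $f_{n,-,-}$ is natural in both variables; the Baer sum makes $\operatorname{Ext}^n_{\mathcal{A}}(A,B)$ an abelian group and $f_{n,A,B}$ is a group homomorphism. 3. Let $n\ge1$ and $A\in\mathcal{A}$. If $f_{n-1,A,B}$ is bijective for every $B\in\mathcal{A}$, then $f_{n,A,B}$ is injective for every $B\in\mathcal{A}$. 4. Let $g_{n,A,B}:\operatorname{Ext}^n_{\mathcal{A}}(A,B)\to\operatorname{Hom}_{\mathcal{T}}(A,B[n])$ be maps, for all $n\ge0$ and $A,B\in\mathcal{A}$, that send the Yoneda product to composition and such that $g_{1,A,B}$ sends the class of each conflation $0\to B\to X\to A\to0$ to the morphism $\delta:A\to B[1]$ of its distinguished triangle. Then $g_{n,A,B}=f_{n,A,B}$ for all $n\ge1$ and $A,B\in\mathcal{A}$. -/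

import Mathlib

open CategoryTheory CategoryTheory.Limits CategoryTheory.Pretriangulated

universe v u

namespace YonedaTriangulated

variable {T : Type u} [Category.{v} T] [Preadditive T] [HasZeroObject T] [HasShift T ℤ]
  [∀ n : ℤ, (shiftFunctor T n).Additive] [Pretriangulated T]

/-- `P` is (the class of objects of) a full, additive, extension-closed subcategory of the
triangulated category `T` such that `Hom(A, B[-1]) = 0` for all objects `A`, `B` of it.
(Closure under finite direct sums follows from extension-closure.) -/
class IsExactSubcategory (P : ObjectProperty T) : Prop extends
    P.ContainsZero, P.IsClosedUnderIsomorphisms, P.IsTriangulatedClosed₂ where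
  hom_neg_one : ∀ {A B : T}, P A → P B → ∀ f : A ⟶ B⟦(-1 : ℤ)⟧, f = 0

variable {P : ObjectProperty T}

/-- A conflation `0 ⟶ B ⟶ X ⟶ A ⟶ 0` in the full subcategory `P`: a pair of morphisms which is part
of a distinguished triangle `B ⟶ X ⟶ A ⟶ B[1]` of `T`. The subcategory being full, morphisms of `P`
are morphisms of `T`. The third morphism is recorded, but equivalence of extensions (see
`NExtension.Maps`) ignores it. -/
structure Conflation (B X A : P.FullSubcategory) where
  i : B.obj ⟶ X.obj
  p : X.obj ⟶ A.obj
  δ : A.obj ⟶ B.obj⟦(1 : ℤ)⟧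
  distinguished : Triangle.mk i p δ ∈ distTriang T

/-- `NExtension k A B` is the type of `(k+1)`-extensions
`0 ⟶ B ⟶ X₁ ⟶ ⋯ ⟶ X_{k+1} ⟶ A ⟶ 0` in the exact category `P`, obtained by splicing `k+1` conflations
`0 ⟶ B ⟶ X₁ ⟶ C₁ ⟶ 0`, `0 ⟶ C₁ ⟶ X₂ ⟶ C₂ ⟶ 0`, ..., `0 ⟶ C_k ⟶ X_{k+1} ⟶ A ⟶ 0`. -/
inductive NExtension : ℕ → P.FullSubcategory → P.FullSubcategory → Type (max u v)
  | single {A B X : P.FullSubcategory} (c : Conflation B X A) : NExtension 0 A B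
  | cons {k : ℕ} {A B X C : P.FullSubcategory} (c : Conflation B X C) (E : NExtension k A C) :
      NExtension (k + 1) A B

namespace NExtension

/-- Given extensions `E`, `E'` of `A` by `B`, `B'` and morphisms `w : W ⟶ B`, `w' : W ⟶ B'`, there is
a family of morphisms `ψᵢ : Xᵢ ⟶ X'ᵢ` such that all the squares
`Xᵢ ⟶ X_{i+1}`, `X'ᵢ ⟶ X'_{i+1}` commute, such that `X_{k+1} ⟶ X'_{k+1} ⟶ A` is `X_{k+1} ⟶ A`, and
such that `W ⟶ B ⟶ X₁ ⟶ X'₁` equals `W ⟶ B' ⟶ X'₁`. -/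
def MapsUnder : {k : ℕ} → {A B B' : P.FullSubcategory} → NExtension k A B → NExtension k A B' →
    {W : T} → (W ⟶ B.obj) → (W ⟶ B'.obj) → Prop
  | _, _, _, _, single (X := X) c, single (X := X') c', _, w, w' =>
      ∃ ψ : X.obj ⟶ X'.obj, w ≫ c.i ≫ ψ = w' ≫ c'.i ∧ ψ ≫ c'.p = c.p
  | _, _, _, _, cons (X := X) c E, cons (X := X') c' E', _, w, w' =>
      ∃ ψ : X.obj ⟶ X'.obj, w ≫ c.i ≫ ψ = w' ≫ c'.i ∧ MapsUnder E E' c.p (ψ ≫ c'.p)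

/-- There is a morphism of exact sequences `E ⟶ E'` which is the identity on both ends. -/
def Maps {k : ℕ} {A B : P.FullSubcategory} (E E' : NExtension k A B) : Prop :=
  MapsUnder E E' (𝟙 B.obj) (𝟙 B.obj)

/-- The composition `A ⟶ C_k[1] ⟶ ⋯ ⟶ C₁[k] ⟶ B[k+1]` of the shifts of the third morphisms of the
distinguished triangles attached to the conflations of an extension. -/
noncomputable def toHom : {k : ℕ} → {A B : P.FullSubcategory} → NExtension k A B →
    ShiftedHom A.obj B.obj ((k + 1 : ℕ) : ℤ)
  | _, _, _, single c => c.δ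
  | _, _, _, cons c E => E.toHom.comp c.δ (by push_cast; ring)

end NExtension

/-- The Yoneda extensions `Ext^n(A, B)` of the exact category `P`: morphisms for `n = 0`, and
`n`-extensions modulo the equivalence relation generated by `NExtension.Maps` for `n > 0`. -/
def YonedaExt : ℕ → P.FullSubcategory → P.FullSubcategory → Type (max u v)
  | 0, A, B => ULift.{u} (A.obj ⟶ B.obj)
  | k + 1, A, B => Quot (NExtension.Maps (k := k) (A := A) (B := B))

namespace YonedaExt

/-- The element of `Ext^0(A, B)` given by a morphism. -/
def ofHom {A B : P.FullSubcategory} (φ : A.obj ⟶ B.obj) : YonedaExt 0 A B := ULift.up φ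

/-- The class of an extension. -/
def mk {k : ℕ} {A B : P.FullSubcategory} (E : NExtension k A B) : YonedaExt (k + 1) A B :=
  Quot.mk _ E

end YonedaExt

/-! ### Pushouts, pullbacks and direct sums of conflations -/

namespace Conflation

variable {A B X : P.FullSubcategory} (c : Conflation B X A)

lemma i_p : c.i ≫ c.p = 0 := comp_distTriang_mor_zero₁₂ _ c.distinguished

lemma i_p_assoc {W : T} (f : A.obj ⟶ W) :
    c.i ≫ c.p ≫ f = 0 ≫ f := by
  rw [← Category.assoc, c.i_p]

lemma δ_i : c.δ ≫ c.i⟦(1 : ℤ)⟧' = 0 := comp_distTriang_mor_zero₃₁ _ c.distinguished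

lemma δ_i_assoc {W : T} (f : X.obj⟦(1 : ℤ)⟧ ⟶ W) :
    c.δ ≫ c.i⟦(1 : ℤ)⟧' ≫ f = 0 ≫ f := by
  rw [← Category.assoc, c.δ_i]

lemma p_δ : c.p ≫ c.δ = 0 := comp_distTriang_mor_zero₂₃ _ c.distinguished

lemma exists_eq_p_comp {W : T} (f : X.obj ⟶ W) (hf : c.i ≫ f = 0) :
    ∃ k : A.obj ⟶ W, f = c.p ≫ k :=
  Triangle.yoneda_exact₂ _ c.distinguished f hf

lemma exists_eq_δ_comp {W : T} (f : A.obj ⟶ W) (hf : c.p ≫ f = 0) :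
    ∃ k : B.obj⟦(1 : ℤ)⟧ ⟶ W, f = c.δ ≫ k :=
  Triangle.yoneda_exact₃ _ c.distinguished f hf

lemma exists_eq_i_comp {W : T} (f : B.obj ⟶ W) (hf : c.δ ≫ f⟦(1 : ℤ)⟧' = 0) :
    ∃ k : X.obj ⟶ W, f = c.i ≫ k := by
  obtain ⟨z, hz⟩ : ∃ z : X.obj⟦(1 : ℤ)⟧ ⟶ W⟦(1 : ℤ)⟧, f⟦(1 : ℤ)⟧' = (-(c.i⟦(1 : ℤ)⟧')) ≫ z :=
    Triangle.yoneda_exact₂ _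
      (rot_of_distTriang _ (rot_of_distTriang _ c.distinguished)) (f⟦(1 : ℤ)⟧') hf
  obtain ⟨k, rfl⟩ := (shiftFunctor T (1 : ℤ)).map_surjective z
  refine ⟨-k, (shiftFunctor T (1 : ℤ)).map_injective ?_⟩
  rw [hz]
  simp

lemma exists_eq_comp_i {W : T} (f : W ⟶ X.obj) (hf : f ≫ c.p = 0) :
    ∃ k : W ⟶ B.obj, f = k ≫ c.i :=
  Triangle.coyoneda_exact₂ _ c.distinguished f hf

lemma exists_eq_comp_p {W : T} (f : W ⟶ A.obj) (hf : f ≫ c.δ = 0) :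
    ∃ k : W ⟶ X.obj, f = k ≫ c.p :=
  Triangle.coyoneda_exact₃ _ c.distinguished f hf

lemma exists_eq_comp_δ {W : T} (f : W ⟶ B.obj⟦(1 : ℤ)⟧) (hf : f ≫ c.i⟦(1 : ℤ)⟧' = 0) :
    ∃ k : W ⟶ A.obj, f = k ≫ c.δ :=
  Triangle.coyoneda_exact₁ _ c.distinguished f hf

/-- A commutative square out of a conflation can be completed: functoriality of the cone. -/
lemma exists_map_of_δ {A' B' X' : P.FullSubcategory} (c' : Conflation B' X' A')
    (g : B.obj ⟶ B'.obj) (a : A.obj ⟶ A'.obj) (h : c.δ ≫ g⟦(1 : ℤ)⟧' = a ≫ c'.δ) :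
    ∃ φ : X.obj ⟶ X'.obj, c.i ≫ φ = g ≫ c'.i ∧ φ ≫ c'.p = c.p ≫ a := by
  obtain ⟨φ, h₁, h₂⟩ :=
    complete_distinguished_triangle_morphism₂ _ _ c.distinguished c'.distinguished g a h
  exact ⟨φ, h₁, h₂.symm⟩

end Conflation

section

variable [IsExactSubcategory P]

lemma hom_shift_one_eq_zero {A B : T} (hA : P A) (hB : P B) (f : A⟦(1 : ℤ)⟧ ⟶ B) : f = 0 := by
  apply (shiftFunctor T (-1 : ℤ)).map_injective
  rw [Functor.map_zero, ← cancel_epi ((shiftFunctorCompIsoId T (1 : ℤ) (-1) (by simp)).inv.app A),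
    comp_zero]
  exact IsExactSubcategory.hom_neg_one hA hB _

lemma exists_conflation {A B : P.FullSubcategory} (δ : A.obj ⟶ B.obj⟦(1 : ℤ)⟧) :
    ∃ (X : P.FullSubcategory) (c : Conflation B X A), c.δ = δ := by
  obtain ⟨X, hX, i, p, h⟩ := P.distinguished_cocone_triangle₂ δ B.property A.property
  exact ⟨⟨X, hX⟩, ⟨i, p, δ, h⟩, rfl⟩

namespace Conflation

variable {A B X : P.FullSubcategory} (c : Conflation B X A)

lemma eq_zero_of_comp_i {W : P.FullSubcategory} (f : W.obj ⟶ B.obj) (hf : f ≫ c.i = 0) :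
    f = 0 := by
  obtain ⟨k, hk⟩ := c.exists_eq_comp_δ (f⟦(1 : ℤ)⟧') (by rw [← Functor.map_comp, hf]; simp)
  have hk0 : k = 0 := hom_shift_one_eq_zero W.property A.property k
  apply (shiftFunctor T (1 : ℤ)).map_injective
  rw [hk, hk0, zero_comp, Functor.map_zero]

lemma eq_zero_of_p_comp {W : P.FullSubcategory} (f : A.obj ⟶ W.obj) (hf : c.p ≫ f = 0) :
    f = 0 := by
  obtain ⟨k, hk⟩ := c.exists_eq_δ_comp f hf
  rw [hk, hom_shift_one_eq_zero B.property W.property k, comp_zero]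

lemma exists_push {C : P.FullSubcategory} (g : B.obj ⟶ C.obj) :
    ∃ (Z : P.FullSubcategory) (d : Conflation C Z A) (φ : X.obj ⟶ Z.obj),
      c.i ≫ φ = g ≫ d.i ∧ φ ≫ d.p = c.p ∧ d.δ = c.δ ≫ g⟦(1 : ℤ)⟧' := by
  obtain ⟨Z, d, hd⟩ := exists_conflation (c.δ ≫ g⟦(1 : ℤ)⟧')
  obtain ⟨φ, h₁, h₂⟩ := c.exists_map_of_δ d g (𝟙 _) (by rw [hd, Category.id_comp])
  exact ⟨Z, d, φ, h₁, by simpa using h₂, hd⟩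

/-- The middle term `g · X` of the conflation `g · c`; see `isPushout`. -/
noncomputable def pushObj {C : P.FullSubcategory} (g : B.obj ⟶ C.obj) : P.FullSubcategory :=
  (c.exists_push g).choose

/-- The conflation `g · c : 0 ⟶ C ⟶ g · X ⟶ A ⟶ 0` for `c : 0 ⟶ B ⟶ X ⟶ A ⟶ 0` and `g : B ⟶ C`,
where `g · X` is the pushout of `g` and `B ⟶ X`. -/
noncomputable def push {C : P.FullSubcategory} (g : B.obj ⟶ C.obj) :
    Conflation C (c.pushObj g) A :=
  (c.exists_push g).choose_spec.choose

/-- The morphism `X ⟶ g · X`. -/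
noncomputable def toPush {C : P.FullSubcategory} (g : B.obj ⟶ C.obj) :
    X.obj ⟶ (c.pushObj g).obj :=
  (c.exists_push g).choose_spec.choose_spec.choose

lemma i_toPush {C : P.FullSubcategory} (g : B.obj ⟶ C.obj) :
    c.i ≫ c.toPush g = g ≫ (c.push g).i :=
  (c.exists_push g).choose_spec.choose_spec.choose_spec.1

lemma i_toPush_assoc {C : P.FullSubcategory} (g : B.obj ⟶ C.obj) {W : T}
    (f : (c.pushObj g).obj ⟶ W) :
    c.i ≫ c.toPush g ≫ f = g ≫ (c.push g).i ≫ f := by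
  rw [← Category.assoc, c.i_toPush g, Category.assoc]

lemma toPush_p {C : P.FullSubcategory} (g : B.obj ⟶ C.obj) :
    c.toPush g ≫ (c.push g).p = c.p :=
  (c.exists_push g).choose_spec.choose_spec.choose_spec.2.1

lemma toPush_p_assoc {C : P.FullSubcategory} (g : B.obj ⟶ C.obj) {W : T}
    (f : A.obj ⟶ W) :
    c.toPush g ≫ (c.push g).p ≫ f = c.p ≫ f := by
  rw [← Category.assoc, c.toPush_p g]

lemma push_δ {C : P.FullSubcategory} (g : B.obj ⟶ C.obj) :
    (c.push g).δ = c.δ ≫ g⟦(1 : ℤ)⟧' :=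
  (c.exists_push g).choose_spec.choose_spec.choose_spec.2.2

lemma push_hom_ext {C W : P.FullSubcategory} (g : B.obj ⟶ C.obj)
    {a b : (c.pushObj g).obj ⟶ W.obj} (h₁ : (c.push g).i ≫ a = (c.push g).i ≫ b)
    (h₂ : c.toPush g ≫ a = c.toPush g ≫ b) : a = b := by
  obtain ⟨k, hk⟩ := (c.push g).exists_eq_p_comp (a - b) (by rw [Preadditive.comp_sub, h₁, sub_self])
  have hk0 : k = 0 := c.eq_zero_of_p_comp k (by
    rw [← c.toPush_p g, Category.assoc, ← hk, Preadditive.comp_sub, h₂, sub_self])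
  rw [hk0, comp_zero] at hk
  exact sub_eq_zero.1 hk

lemma push_exists_desc {C W : P.FullSubcategory} (g : B.obj ⟶ C.obj)
    (a : C.obj ⟶ W.obj) (b : X.obj ⟶ W.obj) (h : g ≫ a = c.i ≫ b) :
    ∃ z : (c.pushObj g).obj ⟶ W.obj, (c.push g).i ≫ z = a ∧ c.toPush g ≫ z = b := by
  obtain ⟨z, hz⟩ := (c.push g).exists_eq_i_comp a (by
    rw [push_δ, Category.assoc, ← Functor.map_comp, h, Functor.map_comp, δ_i_assoc, zero_comp])
  obtain ⟨k, hk⟩ := c.exists_eq_p_comp (c.toPush g ≫ z - b) (by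
    rw [Preadditive.comp_sub, i_toPush_assoc, ← hz, h, sub_self])
  refine ⟨z - (c.push g).p ≫ k, ?_, ?_⟩
  · rw [Preadditive.comp_sub, i_p_assoc, zero_comp, sub_zero, hz]
  · rw [Preadditive.comp_sub, toPush_p_assoc, ← hk, sub_sub_cancel]

/-- In the category `P`, the object `g · X` is the pushout of `g` and `B ⟶ X`. -/
lemma isPushout {C : P.FullSubcategory} (g : B ⟶ C) :
    IsPushout (C := P.FullSubcategory) g (ObjectProperty.homMk c.i)
      (ObjectProperty.homMk (c.push g.hom).i) (ObjectProperty.homMk (c.toPush g.hom)) where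
  w := by ext; exact (c.i_toPush g.hom).symm
  isColimit' := ⟨PushoutCocone.IsColimit.mk _
    (fun s => ObjectProperty.homMk (c.push_exists_desc g.hom s.inl.hom s.inr.hom
      (congrArg InducedCategory.Hom.hom s.condition)).choose)
    (fun s => by
      ext
      exact (c.push_exists_desc g.hom s.inl.hom s.inr.hom
        (congrArg InducedCategory.Hom.hom s.condition)).choose_spec.1)
    (fun s => by
      ext
      exact (c.push_exists_desc g.hom s.inl.hom s.inr.hom
        (congrArg InducedCategory.Hom.hom s.condition)).choose_spec.2)
    (fun s m h₁ h₂ => by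
      have h := (c.push_exists_desc g.hom s.inl.hom s.inr.hom
        (congrArg InducedCategory.Hom.hom s.condition)).choose_spec
      ext
      exact c.push_hom_ext g.hom ((congrArg InducedCategory.Hom.hom h₁).trans h.1.symm)
        ((congrArg InducedCategory.Hom.hom h₂).trans h.2.symm))⟩

lemma exists_pull {A' : P.FullSubcategory} (a : A'.obj ⟶ A.obj) :
    ∃ (Z : P.FullSubcategory) (d : Conflation B Z A') (φ : Z.obj ⟶ X.obj),
      d.i ≫ φ = c.i ∧ φ ≫ c.p = d.p ≫ a ∧ d.δ = a ≫ c.δ := by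
  obtain ⟨Z, d, hd⟩ := exists_conflation (a ≫ c.δ)
  obtain ⟨φ, h₁, h₂⟩ := d.exists_map_of_δ c (𝟙 _) a (by rw [hd]; simp)
  exact ⟨Z, d, φ, by simpa using h₁, h₂, hd⟩

/-- The middle term `X · a` of the conflation `c · a`; see `isPullback`. -/
noncomputable def pullObj {A' : P.FullSubcategory} (a : A'.obj ⟶ A.obj) : P.FullSubcategory :=
  (c.exists_pull a).choose

/-- The conflation `c · a : 0 ⟶ B ⟶ X · a ⟶ A' ⟶ 0` for `c : 0 ⟶ B ⟶ X ⟶ A ⟶ 0` and `a : A' ⟶ A`,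
where `X · a` is the pullback of `a` and `X ⟶ A`. -/
noncomputable def pull {A' : P.FullSubcategory} (a : A'.obj ⟶ A.obj) :
    Conflation B (c.pullObj a) A' :=
  (c.exists_pull a).choose_spec.choose

/-- The morphism `X · a ⟶ X`. -/
noncomputable def fromPull {A' : P.FullSubcategory} (a : A'.obj ⟶ A.obj) :
    (c.pullObj a).obj ⟶ X.obj :=
  (c.exists_pull a).choose_spec.choose_spec.choose

lemma i_fromPull {A' : P.FullSubcategory} (a : A'.obj ⟶ A.obj) :
    (c.pull a).i ≫ c.fromPull a = c.i :=
  (c.exists_pull a).choose_spec.choose_spec.choose_spec.1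

lemma i_fromPull_assoc {A' : P.FullSubcategory} (a : A'.obj ⟶ A.obj) {W : T}
    (f : X.obj ⟶ W) :
    (c.pull a).i ≫ c.fromPull a ≫ f = c.i ≫ f := by
  rw [← Category.assoc, c.i_fromPull a]

lemma fromPull_p {A' : P.FullSubcategory} (a : A'.obj ⟶ A.obj) :
    c.fromPull a ≫ c.p = (c.pull a).p ≫ a :=
  (c.exists_pull a).choose_spec.choose_spec.choose_spec.2.1

lemma pull_δ {A' : P.FullSubcategory} (a : A'.obj ⟶ A.obj) :
    (c.pull a).δ = a ≫ c.δ :=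
  (c.exists_pull a).choose_spec.choose_spec.choose_spec.2.2

lemma pull_exists_lift {A' W : P.FullSubcategory} (a : A'.obj ⟶ A.obj)
    (x : W.obj ⟶ A'.obj) (y : W.obj ⟶ X.obj) (h : x ≫ a = y ≫ c.p) :
    ∃ z : W.obj ⟶ (c.pullObj a).obj, z ≫ (c.pull a).p = x ∧ z ≫ c.fromPull a = y := by
  obtain ⟨z, hz⟩ := (c.pull a).exists_eq_comp_p x (by
    rw [pull_δ, reassoc_of% h, p_δ, comp_zero])
  obtain ⟨k, hk⟩ := c.exists_eq_comp_i (z ≫ c.fromPull a - y) (by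
    rw [Preadditive.sub_comp, Category.assoc, fromPull_p, ← reassoc_of% hz, h, sub_self])
  refine ⟨z - k ≫ (c.pull a).i, ?_, ?_⟩
  · rw [Preadditive.sub_comp, Category.assoc, i_p, comp_zero, sub_zero, hz]
  · rw [Preadditive.sub_comp, Category.assoc, i_fromPull, ← hk, sub_sub_cancel]

/-- The middle term of a pullback conflation is a pullback, so morphisms into it are determined by
their components. -/
lemma pull_hom_ext {A' W : P.FullSubcategory} (a : A'.obj ⟶ A.obj)
    {x y : W.obj ⟶ (c.pullObj a).obj} (h₁ : x ≫ (c.pull a).p = y ≫ (c.pull a).p)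
    (h₂ : x ≫ c.fromPull a = y ≫ c.fromPull a) : x = y := by
  obtain ⟨k, hk⟩ := (c.pull a).exists_eq_comp_i (x - y) (by
    rw [Preadditive.sub_comp, h₁, sub_self])
  have hk0 : k = 0 := c.eq_zero_of_comp_i k (by
    rw [← c.i_fromPull a, ← Category.assoc, ← hk, Preadditive.sub_comp, h₂, sub_self])
  rw [hk0, zero_comp] at hk
  exact sub_eq_zero.1 hk

/-- In the category `P`, the object `X · a` is the pullback of `a` and `X ⟶ A`. -/
lemma isPullback {A' : P.FullSubcategory} (a : A' ⟶ A) :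
    IsPullback (C := P.FullSubcategory) (ObjectProperty.homMk (c.pull a.hom).p)
      (ObjectProperty.homMk (c.fromPull a.hom)) a (ObjectProperty.homMk c.p) where
  w := by ext; exact (c.fromPull_p a.hom).symm
  isLimit' := ⟨PullbackCone.IsLimit.mk _
    (fun s => ObjectProperty.homMk (c.pull_exists_lift a.hom s.fst.hom s.snd.hom
      (congrArg InducedCategory.Hom.hom s.condition)).choose)
    (fun s => by
      ext
      exact (c.pull_exists_lift a.hom s.fst.hom s.snd.hom
        (congrArg InducedCategory.Hom.hom s.condition)).choose_spec.1)
    (fun s => by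
      ext
      exact (c.pull_exists_lift a.hom s.fst.hom s.snd.hom
        (congrArg InducedCategory.Hom.hom s.condition)).choose_spec.2)
    (fun s m h₁ h₂ => by
      have h := (c.pull_exists_lift a.hom s.fst.hom s.snd.hom
        (congrArg InducedCategory.Hom.hom s.condition)).choose_spec
      ext
      exact c.pull_hom_ext a.hom ((congrArg InducedCategory.Hom.hom h₁).trans h.1.symm)
        ((congrArg InducedCategory.Hom.hom h₂).trans h.2.symm))⟩

end Conflation

/-- The direct sum of two objects of `P`. -/
noncomputable def dsum (A B : P.FullSubcategory) : P.FullSubcategory where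
  obj := A.obj ⊞ B.obj
  property := P.ext_of_isTriangulatedClosed₂ _
    (binaryBiproductTriangle_distinguished A.obj B.obj) A.property B.property

end

lemma exists_biprod_iso_pi (Y : Bool → T) : ∃ e : Y true ⊞ Y false ≅ ∏ᶜ Y,
    e.hom ≫ Pi.π Y true = biprod.fst ∧ e.hom ≫ Pi.π Y false = biprod.snd := by
  refine ⟨{ hom := Pi.lift (fun j => match j with
              | true => biprod.fst
              | false => biprod.snd)
            inv := biprod.lift (Pi.π Y true) (Pi.π Y false)
            hom_inv_id := ?_
            inv_hom_id := ?_ }, ?_, ?_⟩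
  · ext <;> simp
  · refine Pi.hom_ext _ _ ?_
    rintro (_ | _) <;> simp
  · simp
  · simp

/-- The direct sum of two morphisms `A ⟶ B[1]`, `A' ⟶ B'[1]`, as a morphism
`A ⊞ A' ⟶ (B ⊞ B')[1]`. -/
noncomputable def biprodδ {A B A' B' : T} (δ : A ⟶ B⟦(1 : ℤ)⟧) (δ' : A' ⟶ B'⟦(1 : ℤ)⟧) :
    A ⊞ A' ⟶ (B ⊞ B')⟦(1 : ℤ)⟧ :=
  biprod.desc (δ ≫ (biprod.inl : B ⟶ B ⊞ B')⟦(1 : ℤ)⟧') (δ' ≫ (biprod.inr : B' ⟶ B ⊞ B')⟦(1 : ℤ)⟧')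

lemma biprodδ_fst {A B A' B' : T} (δ : A ⟶ B⟦(1 : ℤ)⟧) (δ' : A' ⟶ B'⟦(1 : ℤ)⟧) :
    biprodδ δ δ' ≫ (biprod.fst : B ⊞ B' ⟶ B)⟦(1 : ℤ)⟧' = biprod.fst ≫ δ := by
  ext <;> simp [biprodδ, ← Functor.map_comp]

lemma biprodδ_snd {A B A' B' : T} (δ : A ⟶ B⟦(1 : ℤ)⟧) (δ' : A' ⟶ B'⟦(1 : ℤ)⟧) :
    biprodδ δ δ' ≫ (biprod.snd : B ⊞ B' ⟶ B')⟦(1 : ℤ)⟧' = biprod.snd ≫ δ' := by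
  ext <;> simp [biprodδ, ← Functor.map_comp]

lemma biprod_distinguished {A B X A' B' X' : T} {i : B ⟶ X} {p : X ⟶ A} {δ : A ⟶ B⟦(1 : ℤ)⟧}
    {i' : B' ⟶ X'} {p' : X' ⟶ A'} {δ' : A' ⟶ B'⟦(1 : ℤ)⟧}
    (h : Triangle.mk i p δ ∈ distTriang T) (h' : Triangle.mk i' p' δ' ∈ distTriang T) :
    Triangle.mk (biprod.map i i') (biprod.map p p') (biprodδ δ δ') ∈ distTriang T := by
  let F : Bool → Triangle T := fun j => match j with
    | true => Triangle.mk i p δ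
    | false => Triangle.mk i' p' δ'
  have hF : ∀ j, F j ∈ distTriang T := by rintro (_ | _) <;> assumption
  have hprod := productTriangle_distinguished F hF
  obtain ⟨e₁, h₁, h₁'⟩ : ∃ e : B ⊞ B' ≅ ∏ᶜ (fun j => (F j).obj₁),
      e.hom ≫ Pi.π _ true = (biprod.fst : B ⊞ B' ⟶ B) ∧
      e.hom ≫ Pi.π _ false = (biprod.snd : B ⊞ B' ⟶ B') :=
    exists_biprod_iso_pi (fun j => (F j).obj₁)
  obtain ⟨e₂, h₂, h₂'⟩ : ∃ e : X ⊞ X' ≅ ∏ᶜ (fun j => (F j).obj₂),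
      e.hom ≫ Pi.π _ true = (biprod.fst : X ⊞ X' ⟶ X) ∧
      e.hom ≫ Pi.π _ false = (biprod.snd : X ⊞ X' ⟶ X') :=
    exists_biprod_iso_pi (fun j => (F j).obj₂)
  obtain ⟨e₃, h₃, h₃'⟩ : ∃ e : A ⊞ A' ≅ ∏ᶜ (fun j => (F j).obj₃),
      e.hom ≫ Pi.π _ true = (biprod.fst : A ⊞ A' ⟶ A) ∧
      e.hom ≫ Pi.π _ false = (biprod.snd : A ⊞ A' ⟶ A') :=
    exists_biprod_iso_pi (fun j => (F j).obj₃)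
  refine isomorphic_distinguished _ hprod _ (Triangle.isoMk _ _ e₁ e₂ e₃ ?_ ?_ ?_)
  · change biprod.map i i' ≫ e₂.hom = e₁.hom ≫ Limits.Pi.map (fun j => (F j).mor₁)
    refine Pi.hom_ext _ _ ?_
    rintro (_ | _)
    · rw [Category.assoc, Category.assoc, Limits.Pi.map_π, h₂', reassoc_of% h₁']
      exact biprod.map_snd _ _
    · rw [Category.assoc, Category.assoc, Limits.Pi.map_π, h₂, reassoc_of% h₁]
      exact biprod.map_fst _ _
  · change biprod.map p p' ≫ e₃.hom = e₂.hom ≫ Limits.Pi.map (fun j => (F j).mor₂)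
    refine Pi.hom_ext _ _ ?_
    rintro (_ | _)
    · rw [Category.assoc, Category.assoc, Limits.Pi.map_π, h₃', reassoc_of% h₂']
      exact biprod.map_snd _ _
    · rw [Category.assoc, Category.assoc, Limits.Pi.map_π, h₃, reassoc_of% h₂]
      exact biprod.map_fst _ _
  · change biprodδ δ δ' ≫ e₁.hom⟦(1 : ℤ)⟧' =
      e₃.hom ≫ Limits.Pi.map (fun j => (F j).mor₃) ≫ inv (piComparison _ _)
    rw [← cancel_mono (piComparison (shiftFunctor T (1 : ℤ)) (fun j => (F j).obj₁))]
    simp only [Category.assoc, IsIso.inv_hom_id, Category.comp_id]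
    refine Pi.hom_ext _ _ ?_
    rintro (_ | _)
    · simp only [Category.assoc, Limits.Pi.map_π, piComparison_comp_π]
      rw [← Functor.map_comp, h₁', reassoc_of% h₃']
      exact biprodδ_snd δ δ'
    · simp only [Category.assoc, Limits.Pi.map_π, piComparison_comp_π]
      rw [← Functor.map_comp, h₁, reassoc_of% h₃]
      exact biprodδ_fst δ δ'

/-- The direct sum of two conflations. -/
noncomputable def Conflation.dsum [IsExactSubcategory P] {A B X A' B' X' : P.FullSubcategory}
    (c : Conflation B X A) (c' : Conflation B' X' A') :
    Conflation (YonedaTriangulated.dsum B B') (YonedaTriangulated.dsum X X')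
      (YonedaTriangulated.dsum A A') where
  i := biprod.map c.i c'.i
  p := biprod.map c.p c'.p
  δ := biprodδ c.δ c'.δ
  distinguished := biprod_distinguished c.distinguished c'.distinguished

/-! ### Operations on extensions -/

namespace NExtension

lemma MapsUnder.precomp {k : ℕ} {A B B' : P.FullSubcategory} {E : NExtension k A B}
    {E' : NExtension k A B'} {W V : T} {w : W ⟶ B.obj} {w' : W ⟶ B'.obj}
    (h : MapsUnder E E' w w') (q : V ⟶ W) : MapsUnder E E' (q ≫ w) (q ≫ w') := by
  cases E with
  | single c =>
    cases E' with
    | single c' =>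
      obtain ⟨ψ, h₁, h₂⟩ := h
      exact ⟨ψ, by simp [h₁], h₂⟩
  | cons c E =>
    cases E' with
    | cons c' E' =>
      obtain ⟨ψ, h₁, h₂⟩ := h
      exact ⟨ψ, by simp [h₁], h₂⟩

lemma MapsUnder.refl {k : ℕ} {A B : P.FullSubcategory} (E : NExtension k A B) {W : T}
    (w : W ⟶ B.obj) : MapsUnder E E w w := by
  induction E generalizing W with
  | single c => exact ⟨𝟙 _, by simp, by simp⟩
  | cons c E ih => exact ⟨𝟙 _, by simp, by simpa using ih c.p⟩

/-- Splicing `E : 0 ⟶ B ⟶ X₁ ⟶ ⋯ ⟶ A ⟶ 0` and `F : 0 ⟶ C ⟶ Y₁ ⟶ ⋯ ⟶ B ⟶ 0` into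
`F · E : 0 ⟶ C ⟶ Y₁ ⟶ ⋯ ⟶ X₁ ⟶ ⋯ ⟶ A ⟶ 0`. The lengths `k+1` and `l+1` add up. -/
def splice {k : ℕ} {A B : P.FullSubcategory} (E : NExtension k A B) :
    {l : ℕ} → {C : P.FullSubcategory} → NExtension l B C → NExtension (k + 1 + l) A C
  | _, _, single c => cons c E
  | _, _, cons c F => cons c (splice E F)

lemma MapsUnder.splice_left {k : ℕ} {A B : P.FullSubcategory} {E E' : NExtension k A B}
    (h : Maps E E') {l : ℕ} {C : P.FullSubcategory} (F : NExtension l B C) {W : T}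
    (w : W ⟶ C.obj) : MapsUnder (splice E F) (splice E' F) w w := by
  induction F generalizing W with
  | single c => exact ⟨𝟙 _, by simp, by simpa using MapsUnder.precomp h c.p⟩
  | cons c F ih => exact ⟨𝟙 _, by simp, by simpa using ih h c.p⟩

lemma MapsUnder.splice_right {k : ℕ} {A B : P.FullSubcategory} (E : NExtension k A B)
    {l : ℕ} {C C' : P.FullSubcategory} {F : NExtension l B C} {F' : NExtension l B C'} {W : T}
    {w : W ⟶ C.obj} {w' : W ⟶ C'.obj} (h : MapsUnder F F' w w') :
    MapsUnder (splice E F) (splice E F') w w' := by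
  induction F generalizing W C' with
  | single c =>
    cases F' with
    | single c' =>
      obtain ⟨ψ, h₁, h₂⟩ := h
      exact ⟨ψ, h₁, by rw [h₂]; exact MapsUnder.refl E _⟩
  | cons c F ih =>
    cases F' with
    | cons c' F' =>
      obtain ⟨ψ, h₁, h₂⟩ := h
      exact ⟨ψ, h₁, ih E h₂⟩

variable [IsExactSubcategory P]

/-- The extension `g · E`, obtained by replacing `0 ⟶ B ⟶ X₁` by `0 ⟶ C ⟶ g · X₁`. -/
noncomputable def push : {k : ℕ} → {A B C : P.FullSubcategory} → (B.obj ⟶ C.obj) →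
    NExtension k A B → NExtension k A C
  | _, _, _, _, g, single c => single (c.push g)
  | _, _, _, _, g, cons c E => cons (c.push g) E

/-- The extension `E · a`, obtained by replacing `X_{k+1} ⟶ A ⟶ 0` by `X_{k+1} · a ⟶ A' ⟶ 0`. -/
noncomputable def pull {A A' : P.FullSubcategory} (a : A'.obj ⟶ A.obj) :
    {k : ℕ} → {B : P.FullSubcategory} → NExtension k A B → NExtension k A' B
  | _, _, single c => single (c.pull a)
  | _, _, cons c E => cons c (pull a E)

/-- The direct sum of two exact sequences. -/
noncomputable def dsum : {k : ℕ} → {A B A' B' : P.FullSubcategory} → NExtension k A B →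
    NExtension k A' B' →
    NExtension k (YonedaTriangulated.dsum A A') (YonedaTriangulated.dsum B B')
  | _, _, _, _, _, single c, single c' => single (c.dsum c')
  | _, _, _, _, _, cons c E, cons c' E' => cons (c.dsum c') (dsum E E')

lemma Maps.push {k : ℕ} {A B C : P.FullSubcategory} (g : B.obj ⟶ C.obj)
    {E E' : NExtension k A B} (h : Maps E E') : Maps (push g E) (push g E') := by
  cases E with
  | single c =>
    cases E' with
    | single c' =>
      obtain ⟨ψ, h₁, h₂⟩ := h
      simp only [Category.id_comp] at h₁
      obtain ⟨z, hz₁, hz₂⟩ := c.push_exists_desc g (c'.push g).i (ψ ≫ c'.toPush g) (by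
        rw [reassoc_of% h₁, c'.i_toPush])
      refine ⟨z, by simp [hz₁], c.push_hom_ext g ?_ ?_⟩
      · rw [reassoc_of% hz₁, Conflation.i_p, Conflation.i_p]
      · rw [reassoc_of% hz₂, Conflation.toPush_p, h₂, Conflation.toPush_p]
  | cons c E =>
    cases E' with
    | cons c' E' =>
      obtain ⟨ψ, h₁, h₂⟩ := h
      simp only [Category.id_comp] at h₁
      obtain ⟨z, hz₁, hz₂⟩ := c.push_exists_desc g (c'.push g).i (ψ ≫ c'.toPush g) (by
        rw [reassoc_of% h₁, c'.i_toPush])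
      refine ⟨z, by simp [hz₁], ?_⟩
      have key : ∀ {Y Y' : P.FullSubcategory} (u : _ ⟶ Y.obj) (u' : _ ⟶ Y'.obj)
          (φ : Y.obj ⟶ Y'.obj), c.p ≫ u ≫ φ = (ψ ≫ c'.p) ≫ u' →
          (c.push g).p ≫ u ≫ φ = (z ≫ (c'.push g).p) ≫ u' := by
        intro Y Y' u u' φ hu
        apply c.push_hom_ext g
        · simp [Conflation.i_p_assoc, reassoc_of% hz₁]
        · simp [Conflation.toPush_p_assoc, hu, reassoc_of% hz₂]
      cases E with
      | single d =>
        cases E' with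
        | single d' =>
          obtain ⟨φ, h₃, h₄⟩ := h₂
          exact ⟨φ, key _ _ _ h₃, h₄⟩
      | cons d E =>
        cases E' with
        | cons d' E' =>
          obtain ⟨φ, h₃, h₄⟩ := h₂
          exact ⟨φ, key _ _ _ h₃, h₄⟩

lemma MapsUnder.pull {A A' : P.FullSubcategory} (a : A'.obj ⟶ A.obj) {k : ℕ}
    {B B' : P.FullSubcategory} {E : NExtension k A B} {E' : NExtension k A B'}
    {W : P.FullSubcategory} {w : W.obj ⟶ B.obj} {w' : W.obj ⟶ B'.obj}
    (h : MapsUnder E E' w w') : MapsUnder (pull a E) (pull a E') w w' := by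
  induction E generalizing W B' with
  | single c =>
    cases E' with
    | single c' =>
      obtain ⟨ψ, h₁, h₂⟩ := h
      obtain ⟨z, hz₁, hz₂⟩ := c'.pull_exists_lift a (c.pull a).p (c.fromPull a ≫ ψ) (by
        rw [Category.assoc, h₂, Conflation.fromPull_p])
      refine ⟨z, c'.pull_hom_ext a ?_ ?_, hz₁⟩
      · simp [hz₁, Conflation.i_p]
      · simp [hz₂, Conflation.i_fromPull, Conflation.i_fromPull_assoc, h₁]
  | cons c E ih =>
    cases E' with
    | cons c' E' =>
      obtain ⟨ψ, h₁, h₂⟩ := h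
      exact ⟨ψ, h₁, ih a h₂⟩

lemma biprod_map_comp {X X' Y Y' Z Z' : T} (a : X ⟶ Y) (b : Y ⟶ Z) (a' : X' ⟶ Y')
    (b' : Y' ⟶ Z') :
    biprod.map a a' ≫ biprod.map b b' = biprod.map (a ≫ b) (a' ≫ b') := by
  ext <;> simp

lemma MapsUnder.dsum {k : ℕ} {A B B' A₁ B₁ B₁' : P.FullSubcategory}
    {E : NExtension k A B} {E' : NExtension k A B'} {F : NExtension k A₁ B₁}
    {F' : NExtension k A₁ B₁'} {W V : T} {w : W ⟶ B.obj} {w' : W ⟶ B'.obj}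
    {v : V ⟶ B₁.obj} {v' : V ⟶ B₁'.obj} (h : MapsUnder E E' w w') (h' : MapsUnder F F' v v') :
    MapsUnder (E.dsum F) (E'.dsum F') (W := W ⊞ V) (biprod.map w v) (biprod.map w' v') := by
  have key : ∀ {X X' Y Y' : T} {B B' B₁ B₁' : T} {W V : T} {w : W ⟶ B} {w' : W ⟶ B'}
      {v : V ⟶ B₁} {v' : V ⟶ B₁'} {i : B ⟶ X} {i' : B' ⟶ X'} {j : B₁ ⟶ Y} {j' : B₁' ⟶ Y'}
      {ψ : X ⟶ X'} {φ : Y ⟶ Y'}, w ≫ i ≫ ψ = w' ≫ i' → v ≫ j ≫ φ = v' ≫ j' →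
      biprod.map w v ≫ biprod.map i j ≫ biprod.map ψ φ = biprod.map w' v' ≫ biprod.map i' j' := by
    intros
    simp only [biprod_map_comp, *]
  induction E generalizing W V B' B₁ B₁' with
  | single c =>
    cases E' with
    | single c' =>
    cases F with
    | single d =>
    cases F' with
    | single d' =>
      obtain ⟨ψ, h₁, h₂⟩ := h
      obtain ⟨φ, h₃, h₄⟩ := h'
      exact ⟨biprod.map ψ φ, key h₁ h₃, (biprod_map_comp ..).trans (by rw [h₂, h₄]; rfl)⟩
  | cons c E ih =>
    cases E' with
    | cons c' E' =>
    cases F with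
    | cons d F =>
    cases F' with
    | cons d' F' =>
      obtain ⟨ψ, h₁, h₂⟩ := h
      obtain ⟨φ, h₃, h₄⟩ := h'
      refine ⟨biprod.map ψ φ, key h₁ h₃, ?_⟩
      have := ih h₂ h₄
      rw [← biprod_map_comp] at this
      exact this

lemma Maps.dsum {k : ℕ} {A B A' B' : P.FullSubcategory} {E E' : NExtension k A B}
    {F F' : NExtension k A' B'} (h : Maps E E') (h' : Maps F F') :
    Maps (E.dsum F) (E'.dsum F') := by
  have := MapsUnder.dsum h h'
  rwa [show biprod.map (𝟙 B.obj) (𝟙 B'.obj) = 𝟙 (B.obj ⊞ B'.obj) by ext <;> simp] at this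

end NExtension

namespace YonedaExt

/-- The Yoneda product of extensions of positive length: `(E, F) ↦ F · E`. -/
def splice {k l : ℕ} {A B C : P.FullSubcategory} (x : YonedaExt (k + 1) A B)
    (y : YonedaExt (l + 1) B C) : YonedaExt (k + 1 + (l + 1)) A C :=
  Quot.map₂ (fun E F => NExtension.splice E F)
    (fun E _ _ h => NExtension.MapsUnder.splice_right E h)
    (fun _ _ F h => NExtension.MapsUnder.splice_left h F _) x y

variable [IsExactSubcategory P]

/-- The Yoneda product `x ↦ g · x` with a morphism `g : B ⟶ C`. -/
noncomputable def push : {n : ℕ} → {A B C : P.FullSubcategory} → (B.obj ⟶ C.obj) →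
    YonedaExt n A B → YonedaExt n A C
  | 0, _, _, _, g, x => ofHom (ULift.down x ≫ g)
  | _ + 1, _, _, _, g, x => Quot.map (NExtension.push g) (fun _ _ h => h.push g) x

/-- The Yoneda product `x ↦ x · a` with a morphism `a : A' ⟶ A`. -/
noncomputable def pull : {n : ℕ} → {A' A B : P.FullSubcategory} → (A'.obj ⟶ A.obj) →
    YonedaExt n A B → YonedaExt n A' B
  | 0, _, _, _, a, x => ofHom (a ≫ ULift.down x)
  | _ + 1, _, _, _, a, x => Quot.map (NExtension.pull a)
      (fun _ _ h => NExtension.MapsUnder.pull (W := _) a h) x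

/-- The Yoneda product `Ext^n(A, B) × Ext^m(B, C) ⟶ Ext^{n+m}(A, C)`, `(x, y) ↦ y · x`. The degree
of the target is any `k` which is equal to `n + m`. -/
noncomputable def prod : {n m k : ℕ} → {A B C : P.FullSubcategory} → YonedaExt n A B →
    YonedaExt m B C → n + m = k → YonedaExt k A C
  | _, 0, _, A, _, C, x, y, h => cast (congrArg (YonedaExt · A C) h) (push (ULift.down y) x)
  | 0, _ + 1, _, A, _, C, x, y, h =>
      cast (congrArg (YonedaExt · A C) ((Nat.zero_add _).symm.trans h)) (pull (ULift.down x) y)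
  | _ + 1, _ + 1, _, A, _, C, x, y, h => cast (congrArg (YonedaExt · A C) h) (splice x y)

/-- The direct sum `Ext^n(A, B) × Ext^n(A', B') ⟶ Ext^n(A ⊕ A', B ⊕ B')`. -/
noncomputable def dsum : {n : ℕ} → {A B A' B' : P.FullSubcategory} → YonedaExt n A B →
    YonedaExt n A' B' →
    YonedaExt n (YonedaTriangulated.dsum A A') (YonedaTriangulated.dsum B B')
  | 0, _, _, _, _, x, y =>
      ofHom (A := YonedaTriangulated.dsum _ _) (B := YonedaTriangulated.dsum _ _)
        (biprod.map (ULift.down x) (ULift.down y))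
  | _ + 1, _, _, _, _, x, y => Quot.map₂ NExtension.dsum
      (fun E _ _ h => NExtension.Maps.dsum (NExtension.MapsUnder.refl E _) h)
      (fun _ _ F h => NExtension.Maps.dsum h (NExtension.MapsUnder.refl F _)) x y

/-- The Baer sum `x + y = ∇_B · (x ⊕ y) · Δ_A`. -/
noncomputable def baerSum {n : ℕ} {A B : P.FullSubcategory} (x y : YonedaExt n A B) :
    YonedaExt n A B :=
  push (B := YonedaTriangulated.dsum B B) (biprod.desc (𝟙 B.obj) (𝟙 B.obj))
    (pull (A := YonedaTriangulated.dsum A A) (biprod.lift (𝟙 A.obj) (𝟙 A.obj)) (dsum x y))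

end YonedaExt

/-- A morphism `A ⟶ B[n]` factors as `A ⟶ C_{n-1}[1] ⟶ ⋯ ⟶ C₁[n-1] ⟶ B[n]` with all `Cᵢ` in `P`
(no condition if `n ≤ 1`, as there are then no intermediate objects). -/
def FactorsThroughShifts {A : P.FullSubcategory} :
    (n : ℕ) → {B : P.FullSubcategory} → (A.obj ⟶ B.obj⟦(n : ℤ)⟧) → Prop
  | 0, _, _ => True
  | 1, _, _ => True
  | n + 2, B, α => ∃ (C : P.FullSubcategory) (β : A.obj ⟶ C.obj⟦((n + 1 : ℕ) : ℤ)⟧)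
      (γ : C.obj⟦((n + 1 : ℕ) : ℤ)⟧ ⟶ B.obj⟦((n + 2 : ℕ) : ℤ)⟧),
      FactorsThroughShifts (n + 1) β ∧ α = β ≫ γ

end YonedaTriangulated

open YonedaTriangulated

/-! We record a morphism of extensions by its components `Cᵢ ⟶ C'ᵢ` on the splicing objects. Since
`Hom(C[1], C') = 0`, the cone construction shows that such a family comes from a morphism of exact
sequences if and only if it commutes with the connecting morphisms, so `Extⁿ` only depends on the
chain of connecting morphisms and its composition is an invariant. Any two extensions of `A` are
pushouts `g · H`, `g' · H` of a common `H`, and `g · H + g' · H = (g + g') · H`; this yields the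
group axioms and additivity. For injectivity, if `c · E ↦ 0` with `c : 0 ⟶ B ⟶ X ⟶ C ⟶ 0`, then
the image of `E` lifts along `p : X ⟶ C`; by bijectivity in the previous degree `E` is some `p · F`,
so `c · E = (c · p) · F`, and `c · p` splits. -/

namespace YonedaTriangulated

section ShiftedHom

variable {C : Type*} [Category* C] {M : Type*} {X Y Z W : C} {a b c : M}

section AddMonoid

variable [AddMonoid M] [HasShift C M]

lemma comp_shiftedHom_comp (w : X ⟶ Y) (f : ShiftedHom Y Z a) (g : ShiftedHom Z W b)
    (h : b + a = c) : ShiftedHom.comp (w ≫ f) g h = w ≫ f.comp g h :=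
  Category.assoc _ _ _

lemma comp_shift_shiftedHom_comp (f : ShiftedHom X Y a) (w : Y ⟶ Z) (g : ShiftedHom Z W b)
    (h : b + a = c) : ShiftedHom.comp (f ≫ w⟦a⟧') g h = f.comp (w ≫ g) h := by
  simp [ShiftedHom.comp]

lemma shiftedHom_comp_comp_shift (f : ShiftedHom X Y a) (g : ShiftedHom Y Z b) (h : b + a = c)
    (w : Z ⟶ W) : f.comp g h ≫ w⟦c⟧' = f.comp (g ≫ w⟦b⟧') h := by
  rw [← ShiftedHom.comp_mk₀ (f.comp g h) 0 rfl w, ← ShiftedHom.comp_mk₀ g 0 rfl w,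
    ShiftedHom.comp_assoc f g _ h (zero_add b) (by rw [zero_add, h])]

end AddMonoid

lemma exists_comp_eq_shiftedHom_comp [AddGroup M] [HasShift C M] (γ : Y⟦a⟧ ⟶ Z⟦c⟧)
    (h : b + a = c) :
    ∃ δ : ShiftedHom Y Z b, ∀ {X : C} (β : ShiftedHom X Y a), β ≫ γ = β.comp δ h := by
  obtain ⟨δ, hδ⟩ := (shiftFunctor C a).map_surjective (γ ≫ (shiftFunctorAdd' C b a c h).hom.app Z)
  refine ⟨δ, fun β => ?_⟩
  rw [ShiftedHom.comp, hδ, Category.assoc, Iso.hom_inv_id_app]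
  exact congrArg (β ≫ ·) (Category.comp_id γ).symm

end ShiftedHom

lemma hom_comp_cancel_epi {C : Type*} [Category* C] {P : ObjectProperty C}
    {X Y Z : P.FullSubcategory} (w : X ⟶ Y) [Epi w] {f f' : Y.obj ⟶ Z.obj} :
    w.hom ≫ f = w.hom ≫ f' ↔ f = f' := by
  refine ⟨fun h => ?_, fun h => h ▸ rfl⟩
  exact congrArg InducedCategory.Hom.hom ((cancel_epi w (g := ObjectProperty.homMk f)
    (h := ObjectProperty.homMk f')).1 (by ext; exact h))

variable {T : Type u} [Category.{v} T] [Preadditive T] [HasZeroObject T] [HasShift T ℤ]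
  [∀ n : ℤ, (shiftFunctor T n).Additive] [Pretriangulated T]

lemma comp_shift_eq_comp_biprodδ_iff {A B A₁ B₁ A₂ B₂ : T} {δ : A ⟶ B⟦(1 : ℤ)⟧}
    {δ₁ : A₁ ⟶ B₁⟦(1 : ℤ)⟧} {δ₂ : A₂ ⟶ B₂⟦(1 : ℤ)⟧} {a : A ⟶ A₁ ⊞ A₂} {g : B ⟶ B₁ ⊞ B₂} :
    δ ≫ g⟦(1 : ℤ)⟧' = a ≫ biprodδ δ₁ δ₂ ↔
      δ ≫ (g ≫ biprod.fst)⟦(1 : ℤ)⟧' = (a ≫ biprod.fst) ≫ δ₁ ∧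
        δ ≫ (g ≫ biprod.snd)⟦(1 : ℤ)⟧' = (a ≫ biprod.snd) ≫ δ₂ := by
  refine ⟨fun h => ?_, fun ⟨h₁, h₂⟩ => ?_⟩
  · simp [reassoc_of% h, biprodδ_fst, biprodδ_snd]
  · calc δ ≫ g⟦(1 : ℤ)⟧'
        = δ ≫ (g ≫ biprod.fst)⟦(1 : ℤ)⟧' ≫ biprod.inl⟦(1 : ℤ)⟧' +
          δ ≫ (g ≫ biprod.snd)⟦(1 : ℤ)⟧' ≫ biprod.inr⟦(1 : ℤ)⟧' := by
          simp only [← Preadditive.comp_add, ← Functor.map_comp, ← Functor.map_add, Category.assoc,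
            biprod.total, Category.comp_id]
      _ = a ≫ biprodδ δ₁ δ₂ := by
          rw [reassoc_of% h₁, reassoc_of% h₂, ← Preadditive.comp_add, biprodδ, biprod.desc_eq]

lemma exists_eq_comp_shift_mor₂ {t : Triangle T} (ht : t ∈ distTriang T) {W : T} {n m : ℤ}
    (f : ShiftedHom W t.obj₃ n) (h : 1 + n = m) (hf : f.comp t.mor₃ h = 0) :
    ∃ k : ShiftedHom W t.obj₂ n, f = k ≫ t.mor₂⟦n⟧' := by
  have h' : n + 1 = m := by rw [add_comm, h]
  obtain ⟨k, hk⟩ := (ShortComplex.ab_exact_iff _).1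
    ((preadditiveCoyoneda.obj (Opposite.op W)).homologySequence_exact₃ t ht n m h') f
    ((preadditiveCoyoneda_homologySequenceδ_apply t n m h' f).trans hf)
  exact ⟨k, hk.symm⟩

variable {P : ObjectProperty T}

namespace Conflation

lemma exists_comp_δ_of_map {A B X A' B' X' : P.FullSubcategory} (c : Conflation B X A)
    (c' : Conflation B' X' A') (g : B.obj ⟶ B'.obj) (ψ : X.obj ⟶ X'.obj)
    (h : c.i ≫ ψ = g ≫ c'.i) :
    ∃ φ : A.obj ⟶ A'.obj, c.p ≫ φ = ψ ≫ c'.p ∧ c.δ ≫ g⟦(1 : ℤ)⟧' = φ ≫ c'.δ :=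
  complete_distinguished_triangle_morphism _ _ c.distinguished c'.distinguished g ψ h

instance epi_p [IsExactSubcategory P] {A B X : P.FullSubcategory} (c : Conflation B X A) :
    Epi (ObjectProperty.homMk c.p : X ⟶ A) where
  left_cancellation f g h := by
    ext
    refine sub_eq_zero.1 (c.eq_zero_of_p_comp (f.hom - g.hom) ?_)
    rw [Preadditive.comp_sub, sub_eq_zero]
    exact congrArg InducedCategory.Hom.hom h

end Conflation

namespace NExtension

/-- `MapsOver a g E E'` says that there is a morphism of extensions `E ⟶ E'` which is `a` and `g`
on the ends. It is encoded by its components `Cᵢ ⟶ C'ᵢ` on the splicing objects, which are required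
to commute with the connecting morphisms; `maps_iff_mapsOver` compares it with `Maps`. -/
def MapsOver {A A' : P.FullSubcategory} (a : A.obj ⟶ A'.obj) : {k : ℕ} →
    {B B' : P.FullSubcategory} → (B.obj ⟶ B'.obj) → NExtension k A B → NExtension k A' B' → Prop
  | _, _, _, g, single c, single c' => c.δ ≫ g⟦(1 : ℤ)⟧' = a ≫ c'.δ
  | _, _, _, g, cons (C := C) c E, cons (C := C') c' E' =>
      ∃ φ : C.obj ⟶ C'.obj, c.δ ≫ g⟦(1 : ℤ)⟧' = φ ≫ c'.δ ∧ MapsOver a φ E E'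

lemma MapsOver.refl {k : ℕ} {A B : P.FullSubcategory} (E : NExtension k A B) :
    MapsOver (𝟙 A.obj) (𝟙 B.obj) E E := by
  induction E with
  | single c => simp [MapsOver]
  | cons c E ih => exact ⟨𝟙 _, by simp, ih⟩

lemma MapsOver.congr {k : ℕ} {A A' B B' : P.FullSubcategory} {a a' : A.obj ⟶ A'.obj}
    {g g' : B.obj ⟶ B'.obj} {E : NExtension k A B} {E' : NExtension k A' B'}
    (h : MapsOver a g E E') (ha : a = a') (hg : g = g') : MapsOver a' g' E E' := by
  subst ha hg
  exact h

lemma MapsOver.trans {k : ℕ} {A A' A'' B B' B'' : P.FullSubcategory} {a : A.obj ⟶ A'.obj}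
    {a' : A'.obj ⟶ A''.obj} {g : B.obj ⟶ B'.obj} {g' : B'.obj ⟶ B''.obj} {E : NExtension k A B}
    {E' : NExtension k A' B'} {E'' : NExtension k A'' B''} (h : MapsOver a g E E')
    (h' : MapsOver a' g' E' E'') : MapsOver (a ≫ a') (g ≫ g') E E'' := by
  induction E generalizing B' B'' with
  | single c =>
    cases E' with | single c' =>
    cases E'' with | single c'' =>
    simp only [MapsOver] at h h' ⊢
    rw [Functor.map_comp, reassoc_of% h, h', Category.assoc]
  | cons c E ih =>
    cases E' with | cons c' E' =>
    cases E'' with | cons c'' E'' =>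
    obtain ⟨φ, hδ, hφ⟩ := h
    obtain ⟨φ', hδ', hφ'⟩ := h'
    exact ⟨φ ≫ φ', by rw [Functor.map_comp, reassoc_of% hδ, hδ', Category.assoc], ih hφ hφ'⟩

lemma MapsOver.toHom_comp {k : ℕ} {A A' B B' : P.FullSubcategory} {a : A.obj ⟶ A'.obj}
    {g : B.obj ⟶ B'.obj} {E : NExtension k A B} {E' : NExtension k A' B'}
    (h : MapsOver a g E E') : E.toHom ≫ g⟦((k + 1 : ℕ) : ℤ)⟧' = a ≫ E'.toHom := by
  induction E generalizing B' with
  | single c =>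
    cases E' with | single c' =>
    exact h
  | cons c E ih =>
    cases E' with | cons c' E' =>
    obtain ⟨φ, hδ, hφ⟩ := h
    rw [toHom, toHom, shiftedHom_comp_comp_shift, hδ, ← comp_shift_shiftedHom_comp, ih hφ,
      comp_shiftedHom_comp]

lemma toHom_splice {k l : ℕ} {A B C : P.FullSubcategory} (E : NExtension k A B)
    (F : NExtension l B C) :
    (splice E F).toHom = E.toHom.comp F.toHom (by push_cast; ring) := by
  induction F with
  | single c => rfl
  | @cons l _ _ _ _ _ _ ih =>
    have h : (1 : ℤ) + ((l + 1 : ℕ) : ℤ) + ((k + 1 : ℕ) : ℤ) = ((k + 1 + (l + 1) + 1 : ℕ) : ℤ) := by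
      push_cast; ring
    simp only [splice, toHom, ih]
    exact ShiftedHom.comp_assoc _ _ _ _ _ h

lemma factorsThroughShifts_toHom {k : ℕ} {A B : P.FullSubcategory} (E : NExtension k A B) :
    FactorsThroughShifts (k + 1) E.toHom := by
  induction E with
  | single _ => trivial
  | cons c E ih => exact ⟨_, E.toHom, _, ih, rfl⟩

lemma mk_cons_congr {k : ℕ} {A B C X : P.FullSubcategory} (c : Conflation B X C)
    {E E' : NExtension k A C} (h : YonedaExt.mk E = YonedaExt.mk E') :
    YonedaExt.mk (cons c E) = YonedaExt.mk (cons c E') :=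
  congrArg (fun x => YonedaExt.splice x (YonedaExt.mk (single c))) h

variable [IsExactSubcategory P]

lemma mapsUnder_iff_mapsOver {k : ℕ} {A B B' W : P.FullSubcategory} (w : W ⟶ B) [Epi w]
    (g : B.obj ⟶ B'.obj) (E : NExtension k A B) (E' : NExtension k A B') :
    MapsUnder E E' w.hom (w.hom ≫ g) ↔ MapsOver (𝟙 A.obj) g E E' := by
  induction E generalizing B' W with
  | single c =>
    cases E' with | single c' =>
    constructor
    · rintro ⟨ψ, hi, hp⟩
      rw [Category.assoc, hom_comp_cancel_epi] at hi
      obtain ⟨φ, hφ, hδ⟩ := c.exists_comp_δ_of_map c' g ψ hi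
      have hφ_id : φ = 𝟙 _ := (hom_comp_cancel_epi (ObjectProperty.homMk c.p)).1
        (by rw [ObjectProperty.homMk_hom, hφ, hp, Category.comp_id])
      exact hφ_id ▸ hδ
    · intro hδ
      obtain ⟨ψ, hi, hp⟩ := c.exists_map_of_δ c' g (𝟙 _) hδ
      exact ⟨ψ, by rw [hi, Category.assoc], by rw [hp, Category.comp_id]⟩
  | cons c E ih =>
    cases E' with | cons c' E' =>
    have ih_p (φ) := ih (ObjectProperty.homMk c.p) φ E'
    constructor
    · rintro ⟨ψ, hi, hp⟩
      rw [Category.assoc, hom_comp_cancel_epi] at hi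
      obtain ⟨φ, hφ, hδ⟩ := c.exists_comp_δ_of_map c' g ψ hi
      exact ⟨φ, hδ, (ih_p φ).1 (hφ ▸ hp)⟩
    · rintro ⟨φ, hδ, hφ⟩
      obtain ⟨ψ, hi, hp⟩ := c.exists_map_of_δ c' g φ hδ
      exact ⟨ψ, by rw [hi, Category.assoc], hp ▸ (ih_p φ).2 hφ⟩

lemma maps_iff_mapsOver {k : ℕ} {A B : P.FullSubcategory} {E E' : NExtension k A B} :
    Maps E E' ↔ MapsOver (𝟙 A.obj) (𝟙 B.obj) E E' := by
  simpa [Maps] using mapsUnder_iff_mapsOver (𝟙 B) (𝟙 B.obj) E E'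

lemma MapsOver.mk_eq {k : ℕ} {A B : P.FullSubcategory} {E E' : NExtension k A B}
    (h : MapsOver (𝟙 A.obj) (𝟙 B.obj) E E') : YonedaExt.mk E = YonedaExt.mk E' :=
  Quot.sound (maps_iff_mapsOver.2 h)

lemma mapsOver_push_iff {k : ℕ} {A A' B B' C : P.FullSubcategory} {a : A.obj ⟶ A'.obj}
    {g : B.obj ⟶ C.obj} {g' : C.obj ⟶ B'.obj} {E : NExtension k A B} {E' : NExtension k A' B'} :
    MapsOver a g' (push g E) E' ↔ MapsOver a (g ≫ g') E E' := by
  cases E <;> cases E' <;>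
    simp only [push, MapsOver, Conflation.push_δ, Functor.map_comp, Category.assoc]

lemma mapsOver_pull_iff {k : ℕ} {A A' A'' B B' : P.FullSubcategory} {a : A.obj ⟶ A'.obj}
    {a' : A'.obj ⟶ A''.obj} {g : B.obj ⟶ B'.obj} {E : NExtension k A B}
    {E' : NExtension k A'' B'} :
    MapsOver a g E (pull a' E') ↔ MapsOver (a ≫ a') g E E' := by
  induction E generalizing B' with
  | single c =>
    cases E' with | single c' =>
    simp only [pull, MapsOver, Conflation.pull_δ, Category.assoc]
  | cons c E ih =>
    cases E' with | cons c' E' =>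
    simp only [pull, MapsOver, ih]

lemma mapsOver_dsum_iff {k : ℕ} {A B A₁ B₁ A₂ B₂ : P.FullSubcategory}
    {a : A.obj ⟶ A₁.obj ⊞ A₂.obj} {g : B.obj ⟶ B₁.obj ⊞ B₂.obj} {E : NExtension k A B}
    {E₁ : NExtension k A₁ B₁} {E₂ : NExtension k A₂ B₂} :
    MapsOver (A' := YonedaTriangulated.dsum A₁ A₂) (B' := YonedaTriangulated.dsum B₁ B₂)
        a g E (E₁.dsum E₂) ↔
      MapsOver (a ≫ biprod.fst) (g ≫ biprod.fst) E E₁ ∧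
        MapsOver (a ≫ biprod.snd) (g ≫ biprod.snd) E E₂ := by
  induction E generalizing B₁ B₂ with
  | single c =>
    cases E₁ with | single c₁ =>
    cases E₂ with | single c₂ =>
    exact comp_shift_eq_comp_biprodδ_iff
  | cons c E ih =>
    cases E₁ with | cons c₁ E₁ =>
    cases E₂ with | cons c₂ E₂ =>
    constructor
    · rintro ⟨φ, hδ, hφ⟩
      obtain ⟨hδ₁, hδ₂⟩ := comp_shift_eq_comp_biprodδ_iff.1 hδ
      exact ⟨⟨φ ≫ biprod.fst, hδ₁, (ih.1 hφ).1⟩, ⟨φ ≫ biprod.snd, hδ₂, (ih.1 hφ).2⟩⟩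
    · rintro ⟨⟨φ₁, hδ₁, hφ₁⟩, ⟨φ₂, hδ₂, hφ₂⟩⟩
      refine ⟨biprod.lift φ₁ φ₂, comp_shift_eq_comp_biprodδ_iff.2 ?_, ih.2 ?_⟩ <;>
        simp only [biprod.lift_fst, biprod.lift_snd]
      exacts [⟨hδ₁, hδ₂⟩, ⟨hφ₁, hφ₂⟩]

lemma mapsOver_push {k : ℕ} {A B C : P.FullSubcategory} (g : B.obj ⟶ C.obj)
    (E : NExtension k A B) : MapsOver (𝟙 A.obj) g E (push g E) := by
  simpa using mapsOver_push_iff.1 (MapsOver.refl (push g E))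

lemma pull_mapsOver {k : ℕ} {A A' B : P.FullSubcategory} (a : A'.obj ⟶ A.obj)
    (E : NExtension k A B) : MapsOver a (𝟙 B.obj) (pull a E) E := by
  simpa using mapsOver_pull_iff.1 (MapsOver.refl (pull a E))

lemma MapsOver.push_mk {k : ℕ} {A B B' : P.FullSubcategory} {g : B.obj ⟶ B'.obj}
    {E : NExtension k A B} {E' : NExtension k A B'} (h : MapsOver (𝟙 A.obj) g E E') :
    (YonedaExt.mk E).push g = YonedaExt.mk E' :=
  (mapsOver_push_iff.2 (by rwa [Category.comp_id])).mk_eq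

lemma mk_cons_push {k : ℕ} {A B C D X : P.FullSubcategory} (c : Conflation B X C)
    (g : D.obj ⟶ C.obj) (E : NExtension k A D) :
    YonedaExt.mk (cons c (push g E)) = YonedaExt.mk (cons (c.pull g) E) := by
  have h : MapsOver (𝟙 A.obj) (𝟙 B.obj) (cons (c.pull g) E) (cons c (push g E)) :=
    ⟨g, by rw [c.pull_δ, CategoryTheory.Functor.map_id, Category.comp_id], mapsOver_push g E⟩
  exact h.mk_eq.symm

lemma push_zero_mk_cons {k : ℕ} {A B C X : P.FullSubcategory} {c : Conflation B X C}
    (hc : c.δ = 0) (E : NExtension k A C) :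
    (YonedaExt.mk (cons c E)).push (0 : B.obj ⟶ B.obj) = YonedaExt.mk (cons c E) := by
  have h : MapsOver (𝟙 A.obj) 0 (cons c E) (cons c E) :=
    ⟨𝟙 _, by rw [hc, zero_comp, comp_zero], MapsOver.refl E⟩
  exact h.push_mk

lemma exists_mapsOver_pair {k : ℕ} {A B B' : P.FullSubcategory} (E : NExtension k A B)
    (E' : NExtension k A B') : ∃ (D : P.FullSubcategory) (H : NExtension k A D)
      (g : D.obj ⟶ B.obj) (g' : D.obj ⟶ B'.obj),
      MapsOver (𝟙 A.obj) g H E ∧ MapsOver (𝟙 A.obj) g' H E' := by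
  have h := mapsOver_dsum_iff.1 (pull_mapsOver (A := YonedaTriangulated.dsum A A)
    (biprod.lift (𝟙 A.obj) (𝟙 A.obj)) (E.dsum E'))
  rw [biprod.lift_fst, biprod.lift_snd] at h
  exact ⟨_, _, _, _, h⟩

lemma baerSum_mk {k : ℕ} {A B D : P.FullSubcategory} {E E' : NExtension k A B}
    {H : NExtension k A D} {g g' : D.obj ⟶ B.obj} (h : MapsOver (𝟙 A.obj) g H E)
    (h' : MapsOver (𝟙 A.obj) g' H E') :
    (YonedaExt.mk E).baerSum (YonedaExt.mk E') = (YonedaExt.mk H).push (g + g') := by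
  have h_dsum : MapsOver (A' := YonedaTriangulated.dsum A A) (B' := YonedaTriangulated.dsum B B)
      (biprod.lift (𝟙 A.obj) (𝟙 A.obj)) (biprod.lift g g') H (E.dsum E') :=
    mapsOver_dsum_iff.2 (by simpa using ⟨h, h'⟩)
  have h_pull : MapsOver (𝟙 A.obj) (biprod.lift g g') H
      (pull (A := YonedaTriangulated.dsum A A) (biprod.lift (𝟙 A.obj) (𝟙 A.obj)) (E.dsum E')) :=
    mapsOver_pull_iff.2 (h_dsum.congr (Category.id_comp _).symm rfl)
  have h_push := h_pull.trans (mapsOver_push (B := YonedaTriangulated.dsum B B)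
    (biprod.desc (𝟙 B.obj) (𝟙 B.obj)) _)
  have h_add : biprod.lift g g' ≫ biprod.desc (𝟙 B.obj) (𝟙 B.obj) = g + g' := by simp
  exact (h_push.congr (Category.id_comp _) h_add).push_mk.symm

lemma nonempty (k : ℕ) (A B : P.FullSubcategory) : Nonempty (NExtension k A B) := by
  induction k generalizing B with
  | zero =>
    obtain ⟨X, c, -⟩ := exists_conflation (0 : A.obj ⟶ B.obj⟦(1 : ℤ)⟧)
    exact ⟨single c⟩
  | succ k ih =>
    obtain ⟨X, c, -⟩ := exists_conflation (0 : B.obj ⟶ B.obj⟦(1 : ℤ)⟧)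
    exact (ih B).map (cons c)

lemma exists_toHom_eq {k : ℕ} {A B : P.FullSubcategory}
    (α : ShiftedHom A.obj B.obj ((k + 1 : ℕ) : ℤ)) (hα : FactorsThroughShifts (k + 1) α) :
    ∃ E : NExtension k A B, E.toHom = α := by
  induction k generalizing B with
  | zero =>
    obtain ⟨X, c, hc⟩ := exists_conflation (A := A) (B := B) α
    exact ⟨single c, hc⟩
  | succ k ih =>
    obtain ⟨C, β, γ, hβ, rfl⟩ := hα
    obtain ⟨E, rfl⟩ := ih β hβ
    obtain ⟨δ, hδ⟩ := exists_comp_eq_shiftedHom_comp (b := 1) γ (by push_cast; ring)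
    obtain ⟨X, c, rfl⟩ := exists_conflation δ
    exact ⟨cons c E, (hδ E.toHom).symm⟩

end NExtension

namespace YonedaExt

lemma mk_surjective {k : ℕ} {A B : P.FullSubcategory} :
    Function.Surjective (mk : NExtension k A B → YonedaExt (k + 1) A B) :=
  Quot.mk_surjective

lemma ofHom_surjective {A B : P.FullSubcategory} :
    Function.Surjective (ofHom : (A.obj ⟶ B.obj) → YonedaExt 0 A B) :=
  ULift.up_surjective

variable [IsExactSubcategory P]

instance (n : ℕ) (A B : P.FullSubcategory) : Nonempty (YonedaExt n A B) :=
  match n with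
  | 0 => ⟨ofHom 0⟩
  | k + 1 => (NExtension.nonempty k A B).map mk

lemma push_ofHom {A B C : P.FullSubcategory} (g : B.obj ⟶ C.obj) (φ : A.obj ⟶ B.obj) :
    (ofHom φ).push g = ofHom (φ ≫ g) := rfl

lemma push_id {n : ℕ} {A B : P.FullSubcategory} (x : YonedaExt n A B) : x.push (𝟙 B.obj) = x := by
  cases n with
  | zero =>
    obtain ⟨φ, rfl⟩ := ofHom_surjective x
    rw [push_ofHom, Category.comp_id]
  | succ k =>
    obtain ⟨E, rfl⟩ := mk_surjective x
    exact (NExtension.MapsOver.refl E).push_mk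

lemma push_push {n : ℕ} {A B C D : P.FullSubcategory} (g : B.obj ⟶ C.obj) (g' : C.obj ⟶ D.obj)
    (x : YonedaExt n A B) : (x.push g).push g' = x.push (g ≫ g') := by
  cases n with
  | zero =>
    obtain ⟨φ, rfl⟩ := ofHom_surjective x
    simp only [push_ofHom, Category.assoc]
  | succ k =>
    obtain ⟨E, rfl⟩ := mk_surjective x
    have h := (NExtension.mapsOver_push g E).trans (NExtension.mapsOver_push g' (E.push g))
    rw [Category.id_comp] at h
    exact h.push_mk.symm

lemma exists_eq_push_push {n : ℕ} {A B B' : P.FullSubcategory} (x : YonedaExt n A B)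
    (y : YonedaExt n A B') : ∃ (D : P.FullSubcategory) (z : YonedaExt n A D)
      (g : D.obj ⟶ B.obj) (g' : D.obj ⟶ B'.obj), z.push g = x ∧ z.push g' = y := by
  cases n with
  | zero =>
    obtain ⟨φ, rfl⟩ := ofHom_surjective x
    obtain ⟨ψ, rfl⟩ := ofHom_surjective y
    refine ⟨A, ofHom (𝟙 A.obj), φ, ψ, ?_⟩
    simp only [push_ofHom, Category.id_comp, and_self]
  | succ k =>
    obtain ⟨E, rfl⟩ := mk_surjective x
    obtain ⟨E', rfl⟩ := mk_surjective y
    obtain ⟨D, H, g, g', h, h'⟩ := E.exists_mapsOver_pair E'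
    exact ⟨D, mk H, g, g', h.push_mk, h'.push_mk⟩

lemma baerSum_push_push {n : ℕ} {A B D : P.FullSubcategory} (g g' : D.obj ⟶ B.obj)
    (z : YonedaExt n A D) : (z.push g).baerSum (z.push g') = z.push (g + g') := by
  cases n with
  | zero =>
    obtain ⟨φ, rfl⟩ := ofHom_surjective z
    have h : (biprod.lift (𝟙 A.obj) (𝟙 A.obj) ≫ biprod.map (φ ≫ g) (φ ≫ g')) ≫
        biprod.desc (𝟙 B.obj) (𝟙 B.obj) = φ ≫ (g + g') := by simp [biprod.map_eq]
    exact congrArg ofHom h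
  | succ k =>
    obtain ⟨H, rfl⟩ := mk_surjective z
    exact NExtension.baerSum_mk (NExtension.mapsOver_push g H) (NExtension.mapsOver_push g' H)

lemma baerSum_comm {n : ℕ} {A B : P.FullSubcategory} (x y : YonedaExt n A B) :
    x.baerSum y = y.baerSum x := by
  obtain ⟨D, z, g, g', rfl, rfl⟩ := exists_eq_push_push x y
  rw [baerSum_push_push, baerSum_push_push, add_comm]

lemma baerSum_assoc {n : ℕ} {A B : P.FullSubcategory} (x y z : YonedaExt n A B) :
    (x.baerSum y).baerSum z = x.baerSum (y.baerSum z) := by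
  obtain ⟨D, w, g₁, g₂, rfl, rfl⟩ := exists_eq_push_push x y
  obtain ⟨D', w, q, g₃, rfl, rfl⟩ := exists_eq_push_push w z
  simp only [push_push, baerSum_push_push, add_assoc]

lemma push_zero_eq {n : ℕ} {A B : P.FullSubcategory} (x y : YonedaExt n A B) :
    x.push (0 : B.obj ⟶ B.obj) = y.push 0 := by
  obtain ⟨D, z, g, g', rfl, rfl⟩ := exists_eq_push_push x y
  simp only [push_push, comp_zero]

lemma baerSum_push {n : ℕ} {A B : P.FullSubcategory} (g : B.obj ⟶ B.obj) (x : YonedaExt n A B) :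
    x.baerSum (x.push g) = x.push (𝟙 B.obj + g) := by
  rw [← baerSum_push_push, push_id]

/-- `Extⁿ(A, B)` as an abelian group under the Baer sum. Zero is the pushout along `0 : B ⟶ B` of an
arbitrary element, and negation is the pushout along `-𝟙`. -/
noncomputable abbrev addCommGroup (n : ℕ) (A B : P.FullSubcategory) :
    AddCommGroup (YonedaExt n A B) :=
  letI : Add (YonedaExt n A B) := ⟨baerSum⟩
  letI : Neg (YonedaExt n A B) := ⟨push (-𝟙 B.obj)⟩
  letI : Zero (YonedaExt n A B) := ⟨push (0 : B.obj ⟶ B.obj) (Classical.arbitrary _)⟩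
  { AddGroup.ofRightAxioms (G := YonedaExt n A B) baerSum_assoc
      (fun x => (congrArg (baerSum x) (push_zero_eq _ x)).trans
        ((baerSum_push 0 x).trans (by rw [add_zero, push_id])))
      (fun x => (baerSum_push _ x).trans (by rw [add_neg_cancel]; exact push_zero_eq _ _)) with
    add_comm := baerSum_comm }

/-- The map `Extⁿ(A, B) ⟶ Hom(A, B[n])` given by composing the connecting morphisms of the
conflations of an extension. -/
noncomputable def toHom : (n : ℕ) → (A B : P.FullSubcategory) → YonedaExt n A B →
    ShiftedHom A.obj B.obj (n : ℤ)
  | 0, _, _, x => ShiftedHom.mk₀ _ Nat.cast_zero (ULift.down x)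
  | _ + 1, _, _, x => Quot.lift NExtension.toHom
      (fun _ _ h => by simpa using (NExtension.maps_iff_mapsOver.1 h).toHom_comp) x

lemma toHom_ofHom {A B : P.FullSubcategory} (φ : A.obj ⟶ B.obj) :
    toHom 0 A B (ofHom φ) = ShiftedHom.mk₀ ((0 : ℕ) : ℤ) Nat.cast_zero φ := rfl

lemma toHom_mk {k : ℕ} {A B : P.FullSubcategory} (E : NExtension k A B) :
    toHom (k + 1) A B (mk E) = E.toHom := rfl

lemma range_toHom (n : ℕ) (A B : P.FullSubcategory) :
    Set.range (toHom n A B) = {α | FactorsThroughShifts n α} := by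
  ext α
  cases n with
  | zero =>
    obtain ⟨φ, hφ⟩ := (ShiftedHom.homEquiv ((0 : ℕ) : ℤ) Nat.cast_zero).surjective α
    exact ⟨fun _ => trivial, fun _ => ⟨ofHom φ, hφ⟩⟩
  | succ k =>
    constructor
    · rintro ⟨x, rfl⟩
      obtain ⟨E, rfl⟩ := mk_surjective x
      exact E.factorsThroughShifts_toHom
    · intro hα
      obtain ⟨E, rfl⟩ := NExtension.exists_toHom_eq α hα
      exact ⟨mk E, rfl⟩

lemma toHom_push (n : ℕ) {A B C : P.FullSubcategory} (g : B.obj ⟶ C.obj) (x : YonedaExt n A B) :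
    toHom n A C (x.push g) = toHom n A B x ≫ g⟦(n : ℤ)⟧' := by
  cases n with
  | zero =>
    obtain ⟨φ, rfl⟩ := ofHom_surjective x
    rw [push_ofHom, toHom_ofHom, toHom_ofHom, ← ShiftedHom.comp_mk₀ _ ((0 : ℕ) : ℤ) Nat.cast_zero,
      ShiftedHom.mk₀_comp_mk₀]
  | succ k =>
    obtain ⟨E, rfl⟩ := mk_surjective x
    exact ((NExtension.mapsOver_push g E).toHom_comp.trans (Category.id_comp _)).symm

lemma toHom_pull (n : ℕ) {A' A B : P.FullSubcategory} (a : A'.obj ⟶ A.obj) (x : YonedaExt n A B) :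
    toHom n A' B (x.pull a) = a ≫ toHom n A B x := by
  cases n with
  | zero => exact Category.assoc _ _ _
  | succ k =>
    obtain ⟨E, rfl⟩ := mk_surjective x
    have h := (NExtension.pull_mapsOver a E).toHom_comp
    rwa [CategoryTheory.Functor.map_id, Category.comp_id] at h

lemma toHom_prod {n m k : ℕ} (h : n + m = k) {A B C : P.FullSubcategory} (x : YonedaExt n A B)
    (y : YonedaExt m B C) : toHom k A C (x.prod y h) =
      (toHom n A B x).comp (toHom m B C y) (by rw [← h]; push_cast; ring) := by
  match n, m, x, y with
  | n, 0, x, y =>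
    obtain rfl : n = k := h
    rw [prod.eq_1]
    exact (toHom_push _ _ x).trans (ShiftedHom.comp_mk₀ _ _ Nat.cast_zero _).symm
  | 0, m + 1, x, y =>
    obtain rfl : m + 1 = k := by omega
    rw [prod.eq_2]
    exact (toHom_pull _ _ y).trans (ShiftedHom.mk₀_comp _ Nat.cast_zero _ _).symm
  | n + 1, m + 1, x, y =>
    subst h
    obtain ⟨E, rfl⟩ := mk_surjective x
    obtain ⟨F, rfl⟩ := mk_surjective y
    exact NExtension.toHom_splice E F

lemma toHom_baerSum (n : ℕ) {A B : P.FullSubcategory} (x y : YonedaExt n A B) :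
    toHom n A B (x.baerSum y) = toHom n A B x + toHom n A B y := by
  obtain ⟨D, z, g, g', rfl, rfl⟩ := exists_eq_push_push x y
  simp only [baerSum_push_push, toHom_push, Functor.map_add, Preadditive.comp_add]

lemma exists_addCommGroup_toHom (n : ℕ) (A B : P.FullSubcategory) :
    ∃ (_ : AddCommGroup (YonedaExt n A B))
      (F : YonedaExt n A B →+ ShiftedHom A.obj B.obj (n : ℤ)),
      (∀ x y : YonedaExt n A B, x + y = x.baerSum y) ∧ ∀ x, F x = toHom n A B x :=
  letI := addCommGroup n A B
  ⟨inferInstance, AddMonoidHom.mk' (toHom n A B) (toHom_baerSum n), fun _ _ => rfl, fun _ => rfl⟩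

lemma toHom_one_injective (A B : P.FullSubcategory) : Function.Injective (toHom 1 A B) := by
  intro x y hxy
  obtain ⟨E, rfl⟩ := mk_surjective x
  obtain ⟨E', rfl⟩ := mk_surjective y
  cases E with | single c =>
  cases E' with | single c' =>
  have hδ : c.δ = c'.δ := hxy
  have h : NExtension.MapsOver (𝟙 A.obj) (𝟙 B.obj) (.single c) (.single c') := by
    simp [NExtension.MapsOver, hδ]
  exact h.mk_eq

lemma push_zero_eq_self_of_toHom_eq_zero {n : ℕ} {A B : P.FullSubcategory}
    (hA : ∀ B : P.FullSubcategory, Function.Bijective (toHom (n + 1) A B))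
    (x : YonedaExt (n + 2) A B) (hx : toHom (n + 2) A B x = 0) :
    x.push (0 : B.obj ⟶ B.obj) = x := by
  obtain ⟨E, rfl⟩ := mk_surjective x
  cases E with | cons c E =>
  obtain ⟨β, hβ⟩ := exists_eq_comp_shift_mor₂ c.distinguished E.toHom _ hx
  obtain ⟨y, rfl⟩ := (hA _).2 β
  obtain ⟨F, rfl⟩ := mk_surjective y
  have hE : mk E = mk (F.push c.p) := (hA _).1 (hβ.trans (toHom_push _ _ (mk F)).symm)
  rw [(NExtension.mk_cons_congr c hE).trans (NExtension.mk_cons_push c c.p F)]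
  exact NExtension.push_zero_mk_cons (by rw [c.pull_δ, c.p_δ]) F

lemma toHom_succ_injective {n : ℕ} {A : P.FullSubcategory}
    (hA : ∀ B : P.FullSubcategory, Function.Bijective (toHom n A B)) (B : P.FullSubcategory) :
    Function.Injective (toHom (n + 1) A B) := by
  cases n with
  | zero => exact toHom_one_injective A B
  | succ n =>
    let _ := addCommGroup (n + 2) A B
    refine (injective_iff_map_eq_zero
      (AddMonoidHom.mk' (toHom (n + 2) A B) (toHom_baerSum (n + 2)))).2 fun x hx => ?_
    exact (push_zero_eq_self_of_toHom_eq_zero hA x hx).symm.trans (push_zero_eq _ _)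

lemma eq_toHom_of_map_prod
    (g : ∀ (n : ℕ) (A B : P.FullSubcategory), YonedaExt n A B → ShiftedHom A.obj B.obj (n : ℤ))
    (hδ : ∀ (A B X : P.FullSubcategory) (c : Conflation B X A), g 1 A B (mk (.single c)) = c.δ)
    (hprod : ∀ (n m k : ℕ) (h : n + m = k) (A B C : P.FullSubcategory) (x : YonedaExt n A B)
      (y : YonedaExt m B C), g k A C (x.prod y h) =
        (g n A B x).comp (g m B C y) (by rw [← h]; push_cast; ring))
    (n : ℕ) (hn : 1 ≤ n) (A B : P.FullSubcategory) : g n A B = toHom n A B := by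
  obtain ⟨k, rfl⟩ := Nat.exists_eq_add_of_le' hn
  ext x
  obtain ⟨E, rfl⟩ := mk_surjective x
  clear hn
  induction E with
  | single c => exact hδ _ _ _ c
  | @cons k A B X C c E ih =>
    have h := hprod (k + 1) 1 (k + 2) rfl A C B (mk E) (mk (.single c))
    rw [ih, hδ] at h
    exact h

end YonedaExt

end YonedaTriangulated

theorem mainTheorem5_general {T : Type u} [Category.{v} T] [Preadditive T] [HasZeroObject T]
    [HasShift T ℤ] [∀ n : ℤ, (shiftFunctor T n).Additive] [Pretriangulated T]
    (P : ObjectProperty T) [IsExactSubcategory P] :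
    ∃ f : ∀ (n : ℕ) (A B : P.FullSubcategory), YonedaExt n A B → ShiftedHom A.obj B.obj (n : ℤ),
      (∀ (A B : P.FullSubcategory) (φ : A.obj ⟶ B.obj),
        f 0 A B (YonedaExt.ofHom φ) = ShiftedHom.mk₀ ((0 : ℕ) : ℤ) Nat.cast_zero φ) ∧
      (∀ (k : ℕ) (A B : P.FullSubcategory) (E : NExtension k A B),
        f (k + 1) A B (YonedaExt.mk E) = E.toHom) ∧
      (∀ (n : ℕ) (A B : P.FullSubcategory),
        Set.range (f n A B) = {α | FactorsThroughShifts n α}) ∧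
      (∀ (n m k : ℕ) (h : n + m = k) (A B C : P.FullSubcategory) (x : YonedaExt n A B)
        (y : YonedaExt m B C), f k A C (x.prod y h) =
          (f n A B x).comp (f m B C y) (by rw [← h]; push_cast; ring)) ∧
      (∀ (n : ℕ) (A B C : P.FullSubcategory) (g : B.obj ⟶ C.obj) (x : YonedaExt n A B),
        f n A C (x.push g) = f n A B x ≫ g⟦(n : ℤ)⟧') ∧
      (∀ (n : ℕ) (A' A B : P.FullSubcategory) (a : A'.obj ⟶ A.obj) (x : YonedaExt n A B),
        f n A' B (x.pull a) = a ≫ f n A B x) ∧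
      (∀ (n : ℕ) (A B : P.FullSubcategory), ∃ (_ : AddCommGroup (YonedaExt n A B))
        (F : YonedaExt n A B →+ ShiftedHom A.obj B.obj (n : ℤ)),
        (∀ x y : YonedaExt n A B, x + y = x.baerSum y) ∧ ∀ x, F x = f n A B x) ∧
      (∀ (n : ℕ) (A : P.FullSubcategory),
        (∀ B : P.FullSubcategory, Function.Bijective (f n A B)) →
          ∀ B : P.FullSubcategory, Function.Injective (f (n + 1) A B)) ∧
      (∀ g : ∀ (n : ℕ) (A B : P.FullSubcategory), YonedaExt n A B → ShiftedHom A.obj B.obj (n : ℤ),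
        (∀ (A B X : P.FullSubcategory) (c : Conflation B X A),
          g 1 A B (YonedaExt.mk (NExtension.single c)) = c.δ) →
        (∀ (n m k : ℕ) (h : n + m = k) (A B C : P.FullSubcategory) (x : YonedaExt n A B)
          (y : YonedaExt m B C), g k A C (x.prod y h) =
            (g n A B x).comp (g m B C y) (by rw [← h]; push_cast; ring)) →
        ∀ (n : ℕ), 1 ≤ n → ∀ (A B : P.FullSubcategory), g n A B = f n A B) :=
  ⟨YonedaExt.toHom,
    fun _ _ => YonedaExt.toHom_ofHom,
    fun _ _ _ => YonedaExt.toHom_mk,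
    YonedaExt.range_toHom,
    fun _ _ _ h _ _ _ => YonedaExt.toHom_prod h,
    fun n _ _ _ => YonedaExt.toHom_push n,
    fun n _ _ _ => YonedaExt.toHom_pull n,
    YonedaExt.exists_addCommGroup_toHom,
    fun _ _ => YonedaExt.toHom_succ_injective,
    YonedaExt.eq_toHom_of_map_prod⟩

theorem mainTheorem5 {T : Type u} [Category.{v} T] [Preadditive T] [HasZeroObject T]
    [HasShift T ℤ] [∀ n : ℤ, (shiftFunctor T n).Additive] [Pretriangulated T] [IsTriangulated T]
    (P : ObjectProperty T) [IsExactSubcategory P] :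
    ∃ f : ∀ (n : ℕ) (A B : P.FullSubcategory), YonedaExt n A B → ShiftedHom A.obj B.obj (n : ℤ),
      -- the maps `f_n` are those induced by the connecting morphisms of the conflations
      (∀ (A B : P.FullSubcategory) (φ : A.obj ⟶ B.obj),
        f 0 A B (YonedaExt.ofHom φ) = ShiftedHom.mk₀ ((0 : ℕ) : ℤ) Nat.cast_zero φ) ∧
      (∀ (k : ℕ) (A B : P.FullSubcategory) (E : NExtension k A B),
        f (k + 1) A B (YonedaExt.mk E) = E.toHom) ∧
      -- the image
      (∀ (n : ℕ) (A B : P.FullSubcategory),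
        Set.range (f n A B) = {α | FactorsThroughShifts n α}) ∧
      -- Yoneda product is sent to composition
      (∀ (n m k : ℕ) (h : n + m = k) (A B C : P.FullSubcategory) (x : YonedaExt n A B)
        (y : YonedaExt m B C), f k A C (x.prod y h) =
          (f n A B x).comp (f m B C y) (by rw [← h]; push_cast; ring)) ∧
      -- naturality in both variables
      (∀ (n : ℕ) (A B C : P.FullSubcategory) (g : B.obj ⟶ C.obj) (x : YonedaExt n A B),
        f n A C (x.push g) = f n A B x ≫ g⟦(n : ℤ)⟧') ∧
      (∀ (n : ℕ) (A' A B : P.FullSubcategory) (a : A'.obj ⟶ A.obj) (x : YonedaExt n A B),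
        f n A' B (x.pull a) = a ≫ f n A B x) ∧
      -- the Baer sum is an abelian group structure, and `f_n` is a group homomorphism
      (∀ (n : ℕ) (A B : P.FullSubcategory), ∃ (_ : AddCommGroup (YonedaExt n A B))
        (F : YonedaExt n A B →+ ShiftedHom A.obj B.obj (n : ℤ)),
        (∀ x y : YonedaExt n A B, x + y = x.baerSum y) ∧ ∀ x, F x = f n A B x) ∧
      -- if `f_{n-1,A,B}` is bijective for all `B`, then `f_{n,A,B}` is injective for all `B`
      (∀ (n : ℕ) (A : P.FullSubcategory),
        (∀ B : P.FullSubcategory, Function.Bijective (f n A B)) →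
          ∀ B : P.FullSubcategory, Function.Injective (f (n + 1) A B)) ∧
      -- uniqueness
      (∀ g : ∀ (n : ℕ) (A B : P.FullSubcategory), YonedaExt n A B → ShiftedHom A.obj B.obj (n : ℤ),
        (∀ (A B X : P.FullSubcategory) (c : Conflation B X A),
          g 1 A B (YonedaExt.mk (NExtension.single c)) = c.δ) →
        (∀ (n m k : ℕ) (h : n + m = k) (A B C : P.FullSubcategory) (x : YonedaExt n A B)
          (y : YonedaExt m B C), g k A C (x.prod y h) =
            (g n A B x).comp (g m B C y) (by rw [← h]; push_cast; ring)) →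
        ∀ (n : ℕ), 1 ≤ n → ∀ (A B : P.FullSubcategory), g n A B = f n A B) :=
  mainTheorem5_general P
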